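/- Work in the Euclidean plane $\mathbb{R}^2$, starting from the two endpoints $(0,0)$ and $(1,0)$ of a unit segment. A real number $x$ is \emph{ruler and compass constructible} if a segment of length $|x|$ (possibly degenerate) has both endpoints among the points obtainable from the two initial points by finitely many of the following steps: drawing the line through two distinct constructed points; drawing the circle centred at a constructed point whose radius is the distance of two distinct constructed points; taking an intersection point of two distinct constructed lines, of a constructed line and a constructed circle, or of two distinct constructed circles. A real number $x$ is \emph{origami constructible} if a segment of length $|x|$ (possibly degenerate) has both endpoints among the points obtainable from the two initial points by finitely many of the following steps: i) drawing the line through two distinct constructed points; ii) taking the intersection point of two distinct constructed lines that meet; iii) drawing the perpendicular bisector of the segment joining two distinct constructed points; iv) drawing a line that bisects an angle formed by two distinct constructed lines that meet; v) given a constructed line $l$ and constructed points $P\notin l$ and $Q$, drawing a line through $Q$ such that the reflection in it maps $P$ onto $l$, if there is one; vi) given constructed lines $l,m$ and constructed points $P\notin l$, $Q\notin m$ with $(P,l)\neq(Q,m)$, drawing a line such that the reflection in it maps $P$ onto $l$ and $Q$ onto $m$, if there is one. Let $C$ and $\mathcal{O}$ be the sets of ruler and compass constructible and of origami constructible real numbers,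 respectively. Then all the following inclusions are strict: $$\mathbb{Q}\subsetneq C\subsetneq\mathcal{O}\subsetneq\mathbb{R}.$$ -/

import Mathlib

namespace Origami

/-- The Euclidean plane `ℝ²`. -/
abbrev Plane : Type := EuclideanSpace ℝ (Fin 2)

/-- A line of the Euclidean plane: a one-dimensional affine subspace. -/
@[ext]
structure Line where
  toAffine : AffineSubspace ℝ Plane
  finrank_direction : Module.finrank ℝ toAffine.direction = 1

instance : Membership Plane Line := ⟨fun l P => P ∈ l.toAffine⟩

theorem Line.nonempty (l : Line) : (l.toAffine : Set Plane).Nonempty := by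
  rw [AffineSubspace.nonempty_iff_ne_bot]
  intro h
  have h1 := l.finrank_direction
  rw [h, AffineSubspace.direction_bot, finrank_bot] at h1
  exact zero_ne_one h1

instance (l : Line) : Nonempty l.toAffine := l.nonempty.to_subtype

/-- Folding the plane along the line `l`: the orthogonal reflection in `l`. -/
noncomputable def Line.fold (l : Line) : Plane ≃ᵃⁱ[ℝ] Plane :=
  EuclideanGeometry.reflection l.toAffine

/-- The two endpoints of the initial unit segment: the origin and `(1, 0)`. -/
def IsBasePoint (P : Plane) : Prop := P = !₂[(0 : ℝ), 0] ∨ P = !₂[(1 : ℝ), 0]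

/-- The objects occurring in a paper folding construction: points and lines. -/
inductive FoldObject where
  | point (P : Plane)
  | line (l : Line)

open FoldObject in
/-- The points and lines obtained from the unit segment by finitely many paper folding steps.
In the last two steps the given points and lines are the foci and directrices of parabolas
(so that a given point does not lie on the line it is to be folded onto), and in the last step the
two parabolas are different. -/
inductive Foldable : FoldObject → Prop
  | base (P : Plane) : IsBasePoint P → Foldable (point P)
  /-- The line connecting two points. -/
  | join (P Q : Plane) (l : Line) : Foldable (point P) → Foldable (point Q) →
      P ≠ Q → P ∈ l → Q ∈ l → Foldable (line l)
  /-- The intersection point of two lines. -/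
  | meet (l m : Line) (P : Plane) : Foldable (line l) → Foldable (line m) →
      l ≠ m → P ∈ l → P ∈ m → Foldable (point P)
  /-- The perpendicular bisector of the segment connecting two points. -/
  | perpBisector (P Q : Plane) (b : Line) : Foldable (point P) → Foldable (point Q) →
      P ≠ Q → b.toAffine = AffineSubspace.perpBisector P Q → Foldable (line b)
  /-- A line bisecting an angle formed by two lines `l`, `m` that meet at `P`. -/
  | bisector (l m : Line) (P : Plane) (b : Line) : Foldable (line l) → Foldable (line m) →
      l ≠ m → P ∈ l → P ∈ m → P ∈ b → (∀ X ∈ l, b.fold X ∈ m) → Foldable (line b)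
  /-- A line through `Q` reflecting `P` onto `l`. -/
  | fold (l : Line) (P Q : Plane) (b : Line) : Foldable (line l) → Foldable (point P) →
      Foldable (point Q) → P ∉ l → Q ∈ b → b.fold P ∈ l → Foldable (line b)
  /-- A line reflecting simultaneously `P` onto `l` and `Q` onto `m`. -/
  | doubleFold (l m : Line) (P Q : Plane) (b : Line) : Foldable (line l) → Foldable (line m) →
      Foldable (point P) → Foldable (point Q) → P ∉ l → Q ∉ m → (P, l) ≠ (Q, m) →
      b.fold P ∈ l → b.fold Q ∈ m → Foldable (line b)

/-- The set of origami constructible real numbers: `x` such that a segment of length `|x|`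
can be constructed by paper folding. -/
def origamiNumbers : Set ℝ :=
  {x | ∃ P Q : Plane, Foldable (.point P) ∧ Foldable (.point Q) ∧ dist P Q = |x|}

/-- The objects occurring in a ruler and compass construction: points, lines and circles. -/
inductive RulerCompassObject where
  | point (P : Plane)
  | line (l : Line)
  | circle (s : EuclideanGeometry.Sphere Plane)

open RulerCompassObject in
/-- The points, lines and circles obtained from the unit segment by finitely many ruler and
compass steps. -/
inductive Drawable : RulerCompassObject → Prop
  | base (P : Plane) : IsBasePoint P → Drawable (point P)
  /-- The line connecting two points. -/
  | join (P Q : Plane) (l : Line) : Drawable (point P) → Drawable (point Q) →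
      P ≠ Q → P ∈ l → Q ∈ l → Drawable (line l)
  /-- The circle centred at a point whose radius is the distance of two points. -/
  | compass (P Q R : Plane) : Drawable (point P) → Drawable (point Q) → Drawable (point R) →
      Q ≠ R → Drawable (circle ⟨P, dist Q R⟩)
  /-- The intersection point of two lines. -/
  | meetLineLine (l m : Line) (P : Plane) : Drawable (line l) → Drawable (line m) →
      l ≠ m → P ∈ l → P ∈ m → Drawable (point P)
  /-- An intersection point of a line and a circle. -/
  | meetLineCircle (l : Line) (s : EuclideanGeometry.Sphere Plane) (P : Plane) :
      Drawable (line l) → Drawable (circle s) → P ∈ l → P ∈ s → Drawable (point P)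
  /-- An intersection point of two circles. -/
  | meetCircleCircle (s t : EuclideanGeometry.Sphere Plane) (P : Plane) :
      Drawable (circle s) → Drawable (circle t) → s ≠ t → P ∈ s → P ∈ t → Drawable (point P)

/-- The set of real numbers `x` such that a segment of length `|x|` can be constructed
with ruler and compass. -/
def rulerCompassNumbers : Set ℝ :=
  {x | ∃ P Q : Plane, Drawable (.point P) ∧ Drawable (.point Q) ∧ dist P Q = |x|}

end Origami

namespace Origami

/-! Both kinds of construction are compared with subfields of ℝ. If `K` is closed under real square
roots, every ruler and compass step stays over `K`: circles only contribute quadratic equations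
(`SqrtClosed.over_of_drawable`). If `K` is closed under real roots of cubics, every folding step
stays over `K`, since the common tangents of two parabolas are governed by a nonzero cubic
(`CubicClosed.over_of_foldable`).

Conversely, the numbers `x` for which `(x, 0)` can be folded form a field, `foldField`, closed under
square roots because a fold produces tangents to a parabola. Hence every ruler and compass point is
foldable, which gives C ⊆ 𝒪.

The strictness witnesses are √2, ∛2 and a transcendental number. √2 is the diagonal of a unit
square. ∛2 is the slope of a common tangent of two parabolas, but lies in no tower of real quadratic
extensions of ℚ (`QuadTower.cube_ne_two`). The real algebraic numbers are closed under roots of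
cubics, so they contain 𝒪, and they are countable. -/

/-! ### Coordinates, equations of lines, reflections. -/

/-- The point with coordinates `x` and `y`. -/
def pt (x y : ℝ) : Plane := !₂[x, y]

@[simp] theorem pt_zero (x y : ℝ) : pt x y 0 = x := rfl

@[simp] theorem pt_one (x y : ℝ) : pt x y 1 = y := rfl

theorem plane_ext {P Q : Plane} (h0 : P 0 = Q 0) (h1 : P 1 = Q 1) : P = Q := by
  ext i; fin_cases i <;> assumption

theorem pt_eta (P : Plane) : pt (P 0) (P 1) = P := plane_ext rfl rfl

theorem pt_inj {x y x' y' : ℝ} : pt x y = pt x' y' ↔ x = x' ∧ y = y' :=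
  ⟨fun h => ⟨congrArg (· 0) h, congrArg (· 1) h⟩, fun h => by rw [h.1, h.2]⟩

theorem dist_sq (P Q : Plane) : dist P Q ^ 2 = (P 0 - Q 0) ^ 2 + (P 1 - Q 1) ^ 2 := by
  rw [EuclideanSpace.dist_eq, Real.sq_sqrt (by positivity)]
  simp [Fin.sum_univ_two, Real.dist_eq, sq_abs]

theorem dist_eq_iff {P Q : Plane} {r : ℝ} (hr : 0 ≤ r) :
    dist P Q = r ↔ (P 0 - Q 0) ^ 2 + (P 1 - Q 1) ^ 2 = r ^ 2 := by
  rw [← dist_sq, sq_eq_sq₀ dist_nonneg hr]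

theorem dist_eq_dist_iff {P Q R S : Plane} : dist P Q = dist R S ↔
    (P 0 - Q 0) ^ 2 + (P 1 - Q 1) ^ 2 = (R 0 - S 0) ^ 2 + (R 1 - S 1) ^ 2 := by
  rw [dist_eq_iff dist_nonneg, dist_sq]

/-- `l` is the line with equation `a x + b y = c`. -/
def HasEquation (l : Line) (a b c : ℝ) : Prop :=
  0 < a ^ 2 + b ^ 2 ∧ ∀ X : Plane, X ∈ l ↔ a * X 0 + b * X 1 = c

theorem Line.ext_mem {l m : Line} (h : ∀ X : Plane, X ∈ l ↔ X ∈ m) : l = m :=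
  Line.ext (SetLike.ext h)

theorem Line.exists_hasEquation (l : Line) : ∃ a b c, HasEquation l a b c := by
  obtain ⟨p, hp⟩ := l.nonempty
  obtain ⟨v, hv, hs⟩ := finrank_eq_one_iff'.1 l.finrank_direction
  have hv' : (v : Plane) 0 ≠ 0 ∨ (v : Plane) 1 ≠ 0 := by
    by_contra! h
    exact hv (Subtype.ext (plane_ext h.1 h.2))
  have hpos : 0 < (-(v : Plane) 1) ^ 2 + ((v : Plane) 0) ^ 2 := by
    rcases hv' with h | h
    · have := pow_pos (abs_pos.2 h) 2; rw [sq_abs] at this; positivity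
    · have := pow_pos (abs_pos.2 h) 2; rw [sq_abs] at this; rw [neg_sq]; positivity
  refine ⟨-(v : Plane) 1, (v : Plane) 0, -(v : Plane) 1 * p 0 + (v : Plane) 0 * p 1, hpos,
    fun X => ?_⟩
  have hX : X ∈ l ↔ X -ᵥ p ∈ l.toAffine.direction :=
    (AffineSubspace.vsub_right_mem_direction_iff_mem hp X).symm
  rw [hX]
  constructor
  · intro h
    obtain ⟨t, ht⟩ := hs ⟨_, h⟩
    have h0 : t * (v : Plane) 0 = X 0 - p 0 := congrArg (fun w : l.toAffine.direction => (w : Plane) 0) ht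
    have h1 : t * (v : Plane) 1 = X 1 - p 1 := congrArg (fun w : l.toAffine.direction => (w : Plane) 1) ht
    linear_combination (v : Plane) 1 * h0 - (v : Plane) 0 * h1
  · intro h
    have : X -ᵥ p = (((v : Plane) 0 * (X 0 - p 0) + (v : Plane) 1 * (X 1 - p 1)) /
        ((-(v : Plane) 1) ^ 2 + ((v : Plane) 0) ^ 2)) • (v : Plane) := by
      refine plane_ext ?_ ?_ <;>
      simp only [vsub_eq_sub, PiLp.sub_apply, PiLp.smul_apply, smul_eq_mul] <;>
      rw [div_mul_eq_mul_div, eq_div_iff hpos.ne']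
      · linear_combination -(v : Plane) 1 * h
      · linear_combination (v : Plane) 0 * h
    rw [this]
    exact Submodule.smul_mem _ _ v.2

/-- The line with equation `a x + b y = c`. -/
noncomputable def lineOf (a b c : ℝ) (h : 0 < a ^ 2 + b ^ 2) : Line where
  toAffine := AffineSubspace.mk' (pt (a * c / (a ^ 2 + b ^ 2)) (b * c / (a ^ 2 + b ^ 2)))
    (Submodule.span ℝ {pt (-b) a})
  finrank_direction := by
    rw [AffineSubspace.direction_mk']
    refine finrank_span_singleton fun h0 => ?_
    have h1 : -b = 0 := congrArg (· 0) h0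
    have h2 : a = 0 := congrArg (· 1) h0
    nlinarith

theorem hasEquation_lineOf {a b c : ℝ} (h : 0 < a ^ 2 + b ^ 2) :
    HasEquation (lineOf a b c h) a b c := by
  refine ⟨h, fun X => ?_⟩
  change X ∈ AffineSubspace.mk' _ _ ↔ _
  rw [AffineSubspace.mem_mk', Submodule.mem_span_singleton]
  constructor
  · rintro ⟨t, ht⟩
    have h0 : t * -b = X 0 - a * c / (a ^ 2 + b ^ 2) := congrArg (fun w : Plane => w 0) ht
    have h1 : t * a = X 1 - b * c / (a ^ 2 + b ^ 2) := congrArg (fun w : Plane => w 1) ht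
    have : a * (a * c / (a ^ 2 + b ^ 2)) + b * (b * c / (a ^ 2 + b ^ 2)) = c := by
      field_simp
    linear_combination this - a * h0 - b * h1
  · intro hX
    refine ⟨(-b * X 0 + a * X 1) / (a ^ 2 + b ^ 2), plane_ext ?_ ?_⟩ <;>
    simp only [vsub_eq_sub, PiLp.sub_apply, PiLp.smul_apply, smul_eq_mul, pt_zero, pt_one] <;>
    field_simp
    · linear_combination -a * hX
    · linear_combination -b * hX

theorem HasEquation.eq_of_hasEquation {l m : Line} {a b c : ℝ} (hl : HasEquation l a b c)
    (hm : HasEquation m a b c) : l = m :=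
  Line.ext_mem fun X => (hl.2 X).trans (hm.2 X).symm

/-- The coefficients are polynomials in the coordinates of `P` and `Q`, so they stay in any field
containing these. They do not depend on `l`, whence the uniqueness of the line through two points.
-/
theorem hasEquation_of_mem {l : Line} {P Q : Plane} (hPQ : P ≠ Q) (hP : P ∈ l) (hQ : Q ∈ l) :
    HasEquation l (Q 1 - P 1) (P 0 - Q 0) ((Q 1 - P 1) * P 0 + (P 0 - Q 0) * P 1) := by
  obtain ⟨a, b, c, h, hl⟩ := l.exists_hasEquation
  have hP' := (hl P).1 hP
  have hQ' := (hl Q).1 hQ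
  have hpos : 0 < (Q 1 - P 1) ^ 2 + (P 0 - Q 0) ^ 2 := by
    by_contra! h0
    have h1 : Q 1 - P 1 = 0 := by nlinarith [sq_nonneg (Q 1 - P 1), sq_nonneg (P 0 - Q 0)]
    have h2 : P 0 - Q 0 = 0 := by nlinarith [sq_nonneg (Q 1 - P 1), sq_nonneg (P 0 - Q 0)]
    exact hPQ (plane_ext (by linarith) (by linarith))
  refine ⟨hpos, fun X => ?_⟩
  rw [hl X]
  constructor
  · intro hX
    have e : ∀ z : ℝ, (a ^ 2 + b ^ 2) * z = 0 → z = 0 := fun z hz =>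
      (mul_eq_zero.1 hz).resolve_left h.ne'
    refine sub_eq_zero.1 (e _ ?_)
    linear_combination (a * (Q 1 - P 1) + b * (P 0 - Q 0)) * (hX - hP') +
      (b * (X 0 - P 0) - a * (X 1 - P 1)) * (hQ' - hP')
  · intro hX
    have e : ∀ z : ℝ, ((Q 1 - P 1) ^ 2 + (P 0 - Q 0) ^ 2) * z = 0 → z = 0 := fun z hz =>
      (mul_eq_zero.1 hz).resolve_left hpos.ne'
    refine sub_eq_zero.1 (e _ ?_)
    linear_combination (a * (Q 1 - P 1) + b * (P 0 - Q 0)) * hX +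
      ((Q 1 - P 1) ^ 2 + (P 0 - Q 0) ^ 2) * hP' +
      ((X 0 - P 0) * (Q 0 - P 0) + (X 1 - P 1) * (Q 1 - P 1)) * (hQ' - hP')

theorem Line.eq_of_mem {l m : Line} {P Q : Plane} (hPQ : P ≠ Q) (hP : P ∈ l) (hQ : Q ∈ l)
    (hP' : P ∈ m) (hQ' : Q ∈ m) : l = m :=
  (hasEquation_of_mem hPQ hP hQ).eq_of_hasEquation (hasEquation_of_mem hPQ hP' hQ')

/-- Subtracting the normal component once gives the foot of the perpendicular, subtracting it twice
gives the mirror image. -/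
theorem HasEquation.fold_apply {l : Line} {a b c : ℝ} (h : HasEquation l a b c) (X : Plane) :
    l.fold X = pt (X 0 - 2 * (a * X 0 + b * X 1 - c) / (a ^ 2 + b ^ 2) * a)
      (X 1 - 2 * (a * X 0 + b * X 1 - c) / (a ^ 2 + b ^ 2) * b) := by
  have hpos := h.1
  have key : (EuclideanGeometry.orthogonalProjection l.toAffine X : Plane) =
      pt (X 0 - (a * X 0 + b * X 1 - c) / (a ^ 2 + b ^ 2) * a)
        (X 1 - (a * X 0 + b * X 1 - c) / (a ^ 2 + b ^ 2) * b) := by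
    rw [EuclideanGeometry.coe_orthogonalProjection_eq_iff_mem]
    have hmem : pt (X 0 - (a * X 0 + b * X 1 - c) / (a ^ 2 + b ^ 2) * a)
        (X 1 - (a * X 0 + b * X 1 - c) / (a ^ 2 + b ^ 2) * b) ∈ l := by
      rw [h.2]; simp only [pt_zero, pt_one]; field_simp; ring
    refine ⟨hmem, (Submodule.mem_orthogonal _ _).2 fun u hu => ?_⟩
    have hu' := (h.2 _).1 (AffineSubspace.vadd_mem_of_mem_direction hu hmem)
    have hm' := (h.2 _).1 hmem
    simp only [vadd_eq_add, PiLp.add_apply] at hu'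
    simp only [PiLp.inner_apply, Fin.sum_univ_two, vsub_eq_sub, PiLp.sub_apply, pt_zero, pt_one,
      RCLike.inner_apply, conj_trivial]
    linear_combination (a * X 0 + b * X 1 - c) / (a ^ 2 + b ^ 2) * (hu' - hm')
  rw [Line.fold, EuclideanGeometry.reflection_apply', key]
  refine plane_ext ?_ ?_ <;> simp <;> ring

theorem Line.dist_fold_of_mem {l : Line} {A : Plane} (hA : A ∈ l) (X : Plane) :
    dist A (l.fold X) = dist A X := by
  have : l.fold A = A := (EuclideanGeometry.reflection_eq_self_iff _).2 hA
  conv_lhs => rw [← this]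
  exact l.fold.dist_map _ _

theorem Line.fold_eq_self_iff {l : Line} {X : Plane} : l.fold X = X ↔ X ∈ l :=
  EuclideanGeometry.reflection_eq_self_iff _

theorem hasEquation_perpBisector {l : Line} {P Q : Plane} (hPQ : P ≠ Q)
    (h : l.toAffine = AffineSubspace.perpBisector P Q) :
    HasEquation l (2 * (Q 0 - P 0)) (2 * (Q 1 - P 1))
      (Q 0 ^ 2 + Q 1 ^ 2 - P 0 ^ 2 - P 1 ^ 2) := by
  constructor
  · by_contra! h0
    have h1 : Q 1 - P 1 = 0 := by nlinarith [sq_nonneg (Q 1 - P 1), sq_nonneg (Q 0 - P 0)]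
    have h2 : Q 0 - P 0 = 0 := by nlinarith [sq_nonneg (Q 1 - P 1), sq_nonneg (Q 0 - P 0)]
    exact hPQ (plane_ext (by linarith) (by linarith))
  · intro X
    change X ∈ l.toAffine ↔ _
    rw [h, AffineSubspace.mem_perpBisector_iff_dist_eq, dist_eq_dist_iff]
    constructor <;> intro h <;> linarith

theorem Line.toAffine_eq_perpBisector_iff {l : Line} {P Q : Plane} :
    l.toAffine = AffineSubspace.perpBisector P Q ↔ ∀ X : Plane, X ∈ l ↔ dist X P = dist X Q :=
  ⟨fun h X => by
    change X ∈ l.toAffine ↔ _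
    rw [h, AffineSubspace.mem_perpBisector_iff_dist_eq],
  fun h => SetLike.ext fun X => (h X).trans AffineSubspace.mem_perpBisector_iff_dist_eq.symm⟩

/-- The crease carrying `X` to another point is determined by that point. -/
theorem Line.hasEquation_of_fold_ne {l : Line} {X : Plane} (h : X ∉ l) :
    HasEquation l (2 * (l.fold X 0 - X 0)) (2 * (l.fold X 1 - X 1))
      (l.fold X 0 ^ 2 + l.fold X 1 ^ 2 - X 0 ^ 2 - X 1 ^ 2) := by
  obtain ⟨a, b, c, hl⟩ := l.exists_hasEquation
  have hpos := hl.1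
  have hX : a * X 0 + b * X 1 - c ≠ 0 := fun h0 => h ((hl.2 X).2 (by linarith))
  rw [hl.fold_apply]
  simp only [pt_zero, pt_one]
  set k := (a * X 0 + b * X 1 - c) / (a ^ 2 + b ^ 2) with hk
  have hk0 : k ≠ 0 := div_ne_zero hX hpos.ne'
  have hkd : k * (a ^ 2 + b ^ 2) = a * X 0 + b * X 1 - c := div_mul_cancel₀ _ hpos.ne'
  have e : 2 * (a * X 0 + b * X 1 - c) / (a ^ 2 + b ^ 2) = 2 * k := by rw [hk]; ring
  rw [e]
  refine ⟨?_, fun Y => ?_⟩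
  · have : (2 * (X 0 - 2 * k * a - X 0)) ^ 2 + (2 * (X 1 - 2 * k * b - X 1)) ^ 2 =
      16 * k ^ 2 * (a ^ 2 + b ^ 2) := by ring
    rw [this]; positivity
  · rw [hl.2]
    constructor
    · intro h
      linear_combination (-4 * k) * h - 4 * k * hkd
    · intro h
      have e : ∀ z : ℝ, k * z = 0 → z = 0 := fun z hz => (mul_eq_zero.1 hz).resolve_left hk0
      refine sub_eq_zero.1 (e _ ?_)
      linear_combination (-1 / 4) * h - k * hkd

/-! ### Upper bounds: constructions do not leave a sufficiently closed field. -/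

/-- The coordinates of `P` lie in `K`. -/
def PointOver (K : Subfield ℝ) (P : Plane) : Prop := P 0 ∈ K ∧ P 1 ∈ K

/-- `l` has an equation with coefficients in `K`. -/
def LineOver (K : Subfield ℝ) (l : Line) : Prop :=
  ∃ a ∈ K, ∃ b ∈ K, ∃ c ∈ K, HasEquation l a b c

/-- `K` is closed under square roots. -/
def SqrtClosed (K : Subfield ℝ) : Prop := ∀ x : ℝ, x ^ 2 ∈ K → x ∈ K

/-- `K` contains the real roots of nonzero polynomials of degree at most three over `K`. -/
def CubicClosed (K : Subfield ℝ) : Prop := ∀ a ∈ K, ∀ b ∈ K, ∀ c ∈ K, ∀ d ∈ K, ∀ t : ℝ,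
  a * t ^ 3 + b * t ^ 2 + c * t + d = 0 → t ∈ K ∨ (a = 0 ∧ b = 0 ∧ c = 0 ∧ d = 0)

/-- The objects of a ruler and compass construction that are defined over `K`. -/
def RulerCompassObject.Over (K : Subfield ℝ) : RulerCompassObject → Prop
  | .point P => PointOver K P
  | .line l => LineOver K l
  | .circle s => PointOver K s.center ∧ s.radius ^ 2 ∈ K

/-- The objects of a paper folding construction that are defined over `K`. -/
def FoldObject.Over (K : Subfield ℝ) : FoldObject → Prop
  | .point P => PointOver K P
  | .line l => LineOver K l

section

variable {K : Subfield ℝ}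

theorem CubicClosed.sqrtClosed (hK : CubicClosed K) : SqrtClosed K := fun x hx => by
  refine (hK 0 K.zero_mem 1 K.one_mem 0 K.zero_mem (-x ^ 2) (K.neg_mem hx) x (by ring)).resolve_right
    fun h => one_ne_zero h.2.1

theorem IsBasePoint.pointOver {P : Plane} (h : IsBasePoint P) : PointOver K P := by
  rcases h with rfl | rfl
  · exact ⟨K.zero_mem, K.zero_mem⟩
  · exact ⟨K.one_mem, K.zero_mem⟩

theorem PointOver.dist_sq_mem {P Q : Plane} (hP : PointOver K P) (hQ : PointOver K Q) :
    dist P Q ^ 2 ∈ K := by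
  rw [dist_sq]
  exact K.add_mem (pow_mem (K.sub_mem hP.1 hQ.1) 2) (pow_mem (K.sub_mem hP.2 hQ.2) 2)

theorem PointOver.lineOver_of_mem {P Q : Plane} {l : Line} (hP : PointOver K P)
    (hQ : PointOver K Q) (hPQ : P ≠ Q) (hPl : P ∈ l) (hQl : Q ∈ l) : LineOver K l := by
  have h1 := K.sub_mem hQ.2 hP.2
  have h2 := K.sub_mem hP.1 hQ.1
  exact ⟨_, h1, _, h2, _, K.add_mem (K.mul_mem h1 hP.1) (K.mul_mem h2 hP.2),
    hasEquation_of_mem hPQ hPl hQl⟩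

/-- Two different lines through a point have linearly independent normal vectors. -/
theorem HasEquation.det_ne_zero {l m : Line} {a b c a' b' c' : ℝ} {P : Plane}
    (hl : HasEquation l a b c) (hm : HasEquation m a' b' c') (hlm : l ≠ m) (hPl : P ∈ l)
    (hPm : P ∈ m) : a * b' - a' * b ≠ 0 := by
  intro h
  refine hlm (Line.ext_mem fun X => ?_)
  have h1 := (hl.2 P).1 hPl
  have h2 := (hm.2 P).1 hPm
  rw [hl.2, hm.2]
  constructor
  · intro hX
    refine sub_eq_zero.1 ((mul_eq_zero.1 (?_ : (a ^ 2 + b ^ 2) * _ = 0)).resolve_left hl.1.ne')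
    linear_combination (a * a' + b * b') * (hX - h1) +
      (a * (X 1 - P 1) - b * (X 0 - P 0)) * h + (a ^ 2 + b ^ 2) * h2
  · intro hX
    refine sub_eq_zero.1 ((mul_eq_zero.1 (?_ : (a' ^ 2 + b' ^ 2) * _ = 0)).resolve_left hm.1.ne')
    linear_combination (a * a' + b * b') * (hX - h2) -
      (a' * (X 1 - P 1) - b' * (X 0 - P 0)) * h + (a' ^ 2 + b' ^ 2) * h1

/-- Cramer's rule. -/
theorem LineOver.pointOver_of_mem {l m : Line} {P : Plane} (hl : LineOver K l)
    (hm : LineOver K m) (hlm : l ≠ m) (hPl : P ∈ l) (hPm : P ∈ m) : PointOver K P := by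
  obtain ⟨a, ha, b, hb, c, hc, hl⟩ := hl
  obtain ⟨a', ha', b', hb', c', hc', hm⟩ := hm
  have hd := hl.det_ne_zero hm hlm hPl hPm
  have h1 := (hl.2 P).1 hPl
  have h2 := (hm.2 P).1 hPm
  have e0 : P 0 = (c * b' - c' * b) / (a * b' - a' * b) := by
    rw [eq_div_iff hd]; linear_combination b' * h1 - b * h2
  have e1 : P 1 = (a * c' - a' * c) / (a * b' - a' * b) := by
    rw [eq_div_iff hd]; linear_combination a * h2 - a' * h1
  have hdK := K.sub_mem (K.mul_mem ha hb') (K.mul_mem ha' hb)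
  refine ⟨?_, ?_⟩
  · rw [e0]; exact K.div_mem (K.sub_mem (K.mul_mem hc hb') (K.mul_mem hc' hb)) hdK
  · rw [e1]; exact K.div_mem (K.sub_mem (K.mul_mem ha hc') (K.mul_mem ha' hc)) hdK

/-- In the orthogonal frame `(a, b)`, `(-b, a)`, the first component of `P - C` is known from the
equation of `l`; Pythagoras then gives the square of the second. -/
theorem SqrtClosed.pointOver_of_dist (hK : SqrtClosed K) {l : Line} {C P : Plane}
    (hl : LineOver K l) (hC : PointOver K C) (hP : P ∈ l) (hr : dist P C ^ 2 ∈ K) :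
    PointOver K P := by
  obtain ⟨a, ha, b, hb, c, hc, hl⟩ := hl
  have h1 := (hl.2 P).1 hP
  rw [dist_sq] at hr
  have hn : a ^ 2 + b ^ 2 ∈ K := K.add_mem (pow_mem ha 2) (pow_mem hb 2)
  have hu : a * (P 0 - C 0) + b * (P 1 - C 1) ∈ K := by
    have : a * (P 0 - C 0) + b * (P 1 - C 1) = c - (a * C 0 + b * C 1) := by
      linear_combination h1
    rw [this]
    exact K.sub_mem hc (K.add_mem (K.mul_mem ha hC.1) (K.mul_mem hb hC.2))
  have hw : -b * (P 0 - C 0) + a * (P 1 - C 1) ∈ K := by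
    refine hK _ ?_
    have : (-b * (P 0 - C 0) + a * (P 1 - C 1)) ^ 2 =
        (a ^ 2 + b ^ 2) * ((P 0 - C 0) ^ 2 + (P 1 - C 1) ^ 2) -
        (a * (P 0 - C 0) + b * (P 1 - C 1)) ^ 2 := by ring
    rw [this]
    exact K.sub_mem (K.mul_mem hn hr) (pow_mem hu 2)
  have e0 : P 0 = C 0 + (a * (a * (P 0 - C 0) + b * (P 1 - C 1)) -
      b * (-b * (P 0 - C 0) + a * (P 1 - C 1))) / (a ^ 2 + b ^ 2) := by
    have := hl.1.ne'
    field_simp; ring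
  have e1 : P 1 = C 1 + (b * (a * (P 0 - C 0) + b * (P 1 - C 1)) +
      a * (-b * (P 0 - C 0) + a * (P 1 - C 1))) / (a ^ 2 + b ^ 2) := by
    have := hl.1.ne'
    field_simp; ring
  refine ⟨?_, ?_⟩
  · rw [e0]
    exact K.add_mem hC.1 (K.div_mem (K.sub_mem (K.mul_mem ha hu) (K.mul_mem hb hw)) hn)
  · rw [e1]
    exact K.add_mem hC.2 (K.div_mem (K.add_mem (K.mul_mem hb hu) (K.mul_mem ha hw)) hn)

/-- The difference of the two circle equations is the radical axis, a line over `K` through `P`;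
this reduces to a line and a circle. -/
theorem SqrtClosed.pointOver_of_dist_of_dist (hK : SqrtClosed K) {C D P : Plane} (hCD : C ≠ D)
    (hC : PointOver K C) (hD : PointOver K D) (hr : dist P C ^ 2 ∈ K) (hs : dist P D ^ 2 ∈ K) :
    PointOver K P := by
  have h2 : (2 : ℝ) ∈ K := ofNat_mem K 2
  have hpos : 0 < (2 * (D 0 - C 0)) ^ 2 + (2 * (D 1 - C 1)) ^ 2 := by
    have h := pow_pos (dist_pos.2 hCD) 2
    rw [dist_sq] at h
    linarith
  have hl := hasEquation_lineOf (c := dist P C ^ 2 - dist P D ^ 2 +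
    (D 0 ^ 2 + D 1 ^ 2 - C 0 ^ 2 - C 1 ^ 2)) hpos
  refine hK.pointOver_of_dist ⟨_, K.mul_mem h2 (K.sub_mem hD.1 hC.1), _,
    K.mul_mem h2 (K.sub_mem hD.2 hC.2), _, K.add_mem (K.sub_mem hr hs) ?_, hl⟩ hC ?_ hr
  · exact K.sub_mem (K.sub_mem (K.add_mem (pow_mem hD.1 2) (pow_mem hD.2 2)) (pow_mem hC.1 2))
      (pow_mem hC.2 2)
  · rw [hl.2, dist_sq, dist_sq]; ring

theorem SqrtClosed.over_of_drawable (hK : SqrtClosed K) {o : RulerCompassObject}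
    (h : Drawable o) : o.Over K := by
  induction h with
  | base P h => exact h.pointOver
  | join P Q l _ _ hPQ hPl hQl hP hQ => exact PointOver.lineOver_of_mem hP hQ hPQ hPl hQl
  | compass P Q R _ _ _ _ hP hQ hR => exact ⟨hP, PointOver.dist_sq_mem hQ hR⟩
  | meetLineLine l m P _ _ hlm hPl hPm hl hm =>
    exact LineOver.pointOver_of_mem hl hm hlm hPl hPm
  | meetLineCircle l s P _ _ hPl hPs hl hs =>
    exact hK.pointOver_of_dist hl hs.1 hPl (by rw [EuclideanGeometry.mem_sphere.1 hPs]; exact hs.2)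
  | meetCircleCircle s t P _ _ hst hPs hPt hs ht =>
    rw [EuclideanGeometry.mem_sphere] at hPs hPt
    refine hK.pointOver_of_dist_of_dist (fun hc => hst ?_) hs.1 ht.1
      (by rw [hPs]; exact hs.2) (by rw [hPt]; exact ht.2)
    exact EuclideanGeometry.Sphere.ext hc (by rw [← hPs, ← hPt, hc])

theorem PointOver.lineOver_perpBisector {P Q : Plane} {l : Line} (hP : PointOver K P)
    (hQ : PointOver K Q) (h : HasEquation l (2 * (Q 0 - P 0)) (2 * (Q 1 - P 1))
      (Q 0 ^ 2 + Q 1 ^ 2 - P 0 ^ 2 - P 1 ^ 2)) : LineOver K l := by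
  have h2 : (2 : ℝ) ∈ K := ofNat_mem K 2
  exact ⟨_, K.mul_mem h2 (K.sub_mem hQ.1 hP.1), _, K.mul_mem h2 (K.sub_mem hQ.2 hP.2), _,
    K.sub_mem (K.sub_mem (K.add_mem (pow_mem hQ.1 2) (pow_mem hQ.2 2)) (pow_mem hP.1 2))
      (pow_mem hP.2 2), h⟩

/-- The image of `P` lies on `l` and on the circle about `Q` through `P`, so it is over `K`; the
crease is the perpendicular bisector of `P` and its image. -/
theorem SqrtClosed.lineOver_of_fold (hK : SqrtClosed K) {l b : Line} {P Q : Plane}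
    (hl : LineOver K l) (hP : PointOver K P) (hQ : PointOver K Q) (hPb : P ∉ b) (hQb : Q ∈ b)
    (hPl : b.fold P ∈ l) : LineOver K b := by
  refine hP.lineOver_perpBisector (hK.pointOver_of_dist hl hQ hPl ?_)
    (Line.hasEquation_of_fold_ne hPb)
  rw [dist_comm, Line.dist_fold_of_mem hQb]
  exact hQ.dist_sq_mem hP

/-- A line over `K` contains a second point over `K`. -/
theorem LineOver.exists_ne {l : Line} {P : Plane} (hl : LineOver K l) (hP : PointOver K P)
    (hPl : P ∈ l) : ∃ A, PointOver K A ∧ A ∈ l ∧ A ≠ P := by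
  obtain ⟨a, ha, b, hb, c, hc, hl⟩ := hl
  refine ⟨pt (P 0 - b) (P 1 + a), ⟨K.sub_mem hP.1 hb, K.add_mem hP.2 ha⟩, (hl.2 _).2 ?_, ?_⟩
  · have := (hl.2 P).1 hPl
    simp only [pt_zero, pt_one]
    linear_combination this
  · intro h
    have h0 : P 0 - b = P 0 := congrArg (fun X : Plane => X 0) h
    have h1 : P 1 + a = P 1 := congrArg (fun X : Plane => X 1) h
    have := hl.1
    rw [show a = 0 by linarith, show b = 0 by linarith] at this
    norm_num at this

/-- The parabolas with focus `P`, directrix `l` and with focus `Q`, directrix `m` have finitely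
many common tangents, given by a cubic equation. -/
theorem CubicClosed.lineOver_of_doubleFold (hK : CubicClosed K) {l m b : Line} {P Q : Plane}
    (hl : LineOver K l) (hm : LineOver K m) (hP : PointOver K P) (hQ : PointOver K Q)
    (hPl : P ∉ l) (hQm : Q ∉ m) (hne : (P, l) ≠ (Q, m)) (hPb : b.fold P ∈ l)
    (hQb : b.fold Q ∈ m) : LineOver K b := by
  have hPb' : P ∉ b := fun h => hPl (by rwa [Line.fold_eq_self_iff.2 h] at hPb)
  have hb := Line.hasEquation_of_fold_ne hPb'
  -- It suffices that the image of `P` has coordinates in `K`.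
  refine hP.lineOver_perpBisector ?_ hb
  obtain ⟨a₁, ha₁, a₂, ha₂, c, hc, hl⟩ := hl
  obtain ⟨w₁, hw₁, w₂, hw₂, d, hd, hm⟩ := hm
  have hP' := (hl.2 _).1 hPb
  have hQ' := (hm.2 _).1 hQb
  rw [hb.fold_apply Q] at hQ'
  have hbpos := hb.1
  set x := b.fold P 0 with hx
  set y := b.fold P 1 with hy
  simp only [pt_zero, pt_one] at hQ'
  have hN := hl.1
  -- `h = (h₁, h₂)` is the foot of the perpendicular from `P` to `l`, relative to `P`
  have hk : a₁ * P 0 + a₂ * P 1 - c ≠ 0 := fun h0 => hPl ((hl.2 P).2 (by linarith))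
  obtain ⟨k, hkK, hkd⟩ : ∃ k ∈ K, k * (a₁ ^ 2 + a₂ ^ 2) = c - (a₁ * P 0 + a₂ * P 1) :=
    ⟨_, K.div_mem (K.sub_mem hc (K.add_mem (K.mul_mem ha₁ hP.1) (K.mul_mem ha₂ hP.2)))
      (K.add_mem (pow_mem ha₁ 2) (pow_mem ha₂ 2)), div_mul_cancel₀ _ hN.ne'⟩
  have hk0 : k ≠ 0 := fun h => hk (by rw [h] at hkd; linarith)
  -- The image of `P` is the foot of the perpendicular shifted along `l` by `t`, the only unknown
  -- left.
  obtain ⟨t, h0, h1⟩ : ∃ t, x = P 0 + k * a₁ - t * a₂ ∧ y = P 1 + k * a₂ + t * a₁ := by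
    refine ⟨(-a₂ * (x - P 0) + a₁ * (y - P 1)) / (a₁ ^ 2 + a₂ ^ 2), ?_, ?_⟩ <;> field_simp
    · linear_combination a₁ * hP' - a₁ * hkd
    · linear_combination a₂ * hP' - a₂ * hkd
  have hQ0 := K.sub_mem hQ.1 hP.1
  have hQ1 := K.sub_mem hQ.2 hP.2
  have h2 : (2 : ℝ) ∈ K := ofNat_mem K 2
  obtain ⟨n, hn⟩ : ∃ n, n = a₁ ^ 2 + a₂ ^ 2 := ⟨_, rfl⟩
  obtain ⟨e, he⟩ : ∃ e, e = w₁ * Q 0 + w₂ * Q 1 - d := ⟨_, rfl⟩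
  -- Inner products of `Q - P` (`α`, `β`) and of the normal of `m` (`γ`, `δ`) with the frame `(a₁,
  -- a₂)`, `(-a₂, a₁)`.
  obtain ⟨α, hα⟩ : ∃ α, α = a₁ * (Q 0 - P 0) + a₂ * (Q 1 - P 1) := ⟨_, rfl⟩
  obtain ⟨β, hβ⟩ : ∃ β, β = -a₂ * (Q 0 - P 0) + a₁ * (Q 1 - P 1) := ⟨_, rfl⟩
  obtain ⟨γ, hγ⟩ : ∃ γ, γ = w₁ * a₁ + w₂ * a₂ := ⟨_, rfl⟩
  obtain ⟨δ, hδ⟩ : ∃ δ, δ = -w₁ * a₂ + w₂ * a₁ := ⟨_, rfl⟩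
  have hnK : n ∈ K := hn ▸ K.add_mem (pow_mem ha₁ 2) (pow_mem ha₂ 2)
  have heK : e ∈ K := he ▸ K.sub_mem (K.add_mem (K.mul_mem hw₁ hQ.1) (K.mul_mem hw₂ hQ.2)) hd
  have hαK : α ∈ K := hα ▸ K.add_mem (K.mul_mem ha₁ hQ0) (K.mul_mem ha₂ hQ1)
  have hβK : β ∈ K := hβ ▸ K.add_mem (K.mul_mem (K.neg_mem ha₂) hQ0) (K.mul_mem ha₁ hQ1)
  have hγK : γ ∈ K := hγ ▸ K.add_mem (K.mul_mem hw₁ ha₁) (K.mul_mem hw₂ ha₂)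
  have hδK : δ ∈ K := hδ ▸ K.add_mem (K.mul_mem (K.neg_mem hw₁) ha₂) (K.mul_mem hw₂ ha₁)
  have hn0 : n ≠ 0 := hn ▸ hN.ne'
  have he0 : e ≠ 0 := fun h0 => hQm ((hm.2 Q).2 (by linarith))
  -- the condition that `Q` is folded onto `m`
  have key : e * (n * (k ^ 2 + t ^ 2)) +
      (n * (k ^ 2 + t ^ 2) - 2 * (k * α + t * β)) * (k * γ + t * δ) = 0 := by
    obtain ⟨r, hr⟩ : ∃ r, r = (2 * (x - P 0) * Q 0 + 2 * (y - P 1) * Q 1 -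
        (x ^ 2 + y ^ 2 - P 0 ^ 2 - P 1 ^ 2)) /
        ((2 * (x - P 0)) ^ 2 + (2 * (y - P 1)) ^ 2) := ⟨_, rfl⟩
    rw [mul_div_assoc, ← hr] at hQ'
    rw [eq_div_iff hbpos.ne', h0, h1] at hr
    rw [h0, h1] at hQ'
    rw [hn, he, hα, hβ, hγ, hδ]
    -- The denominator of `r` is `4 * n * (k ^ 2 + t ^ 2)`, hence the factor `4`.
    refine (mul_eq_zero.1 (?_ : (4 : ℝ) * _ = 0)).resolve_left (by norm_num)
    linear_combination (4 * (a₁ ^ 2 + a₂ ^ 2) * (k ^ 2 + t ^ 2)) * hQ' +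
      4 * (w₁ * (k * a₁ - t * a₂) + w₂ * (k * a₂ + t * a₁)) * hr
  have htK : t ∈ K := by
    refine (hK (n * δ) (K.mul_mem hnK hδK) (e * n + n * k * γ - 2 * β * δ) ?_
      (n * k ^ 2 * δ - 2 * k * α * δ - 2 * k * β * γ) ?_
      (e * n * k ^ 2 + n * k ^ 3 * γ - 2 * k ^ 2 * α * γ) ?_ t
      (by linear_combination key)).resolve_right ?_
    · exact K.sub_mem (K.add_mem (K.mul_mem heK hnK) (K.mul_mem (K.mul_mem hnK hkK) hγK))
        (K.mul_mem (K.mul_mem h2 hβK) hδK)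
    · exact K.sub_mem (K.sub_mem (K.mul_mem (K.mul_mem hnK (pow_mem hkK 2)) hδK)
        (K.mul_mem (K.mul_mem (K.mul_mem h2 hkK) hαK) hδK))
        (K.mul_mem (K.mul_mem (K.mul_mem h2 hkK) hβK) hγK)
    · exact K.sub_mem (K.add_mem (K.mul_mem (K.mul_mem heK hnK) (pow_mem hkK 2))
        (K.mul_mem (K.mul_mem hnK (pow_mem hkK 3)) hγK))
        (K.mul_mem (K.mul_mem (K.mul_mem h2 (pow_mem hkK 2)) hαK) hγK)
    -- If the cubic in `t` vanished identically, `δ = 0` would make `m` parallel to `l`, the other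
    -- coefficients would force `P = Q`, and then `l = m`: the parabolas would coincide.
    rintro ⟨z3, z2, z1, z0⟩
    have hδ0 : δ = 0 := (mul_eq_zero.1 z3).resolve_left hn0
    have hekγ : e + k * γ = 0 := by
      refine (mul_eq_zero.1 (?_ : n * _ = 0)).resolve_left hn0
      rw [hδ0] at z2
      linear_combination z2
    have hγ0 : γ ≠ 0 := fun h => he0 (by rw [h] at hekγ; linarith)
    have hβ0 : β = 0 := by
      refine (mul_eq_zero.1 (?_ : (k * γ) * _ = 0)).resolve_left (mul_ne_zero hk0 hγ0)
      rw [hδ0] at z1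
      linear_combination -z1 / 2
    have hα0 : α = 0 := by
      refine (mul_eq_zero.1 (?_ : (k ^ 2 * γ) * _ = 0)).resolve_left
        (mul_ne_zero (pow_ne_zero 2 hk0) hγ0)
      linear_combination -z0 / 2 + n * k ^ 2 * hekγ / 2
    have e0 : Q 0 - P 0 = 0 := by
      refine (mul_eq_zero.1 (?_ : n * _ = 0)).resolve_left hn0
      rw [hn]
      linear_combination a₁ * (hα0 - hα) - a₂ * (hβ0 - hβ)
    have e1 : Q 1 - P 1 = 0 := by
      refine (mul_eq_zero.1 (?_ : n * _ = 0)).resolve_left hn0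
      rw [hn]
      linear_combination a₂ * (hα0 - hα) + a₁ * (hβ0 - hβ)
    have hPQ : P = Q := plane_ext (by linarith) (by linarith)
    have hw1 : n * w₁ = γ * a₁ := by
      rw [hn, hγ]; linear_combination a₂ * (hδ - hδ0)
    have hw2 : n * w₂ = γ * a₂ := by
      rw [hn, hγ]; linear_combination -a₁ * (hδ - hδ0)
    have hd' : n * d = γ * c := by
      rw [← hPQ] at he
      rw [← hn] at hkd
      linear_combination n * he + P 0 * hw1 + P 1 * hw2 - n * hekγ + γ * hkd
    refine hne (Prod.ext hPQ (Line.ext_mem fun X => ?_))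
    rw [hl.2, hm.2]
    constructor
    · intro hX
      refine sub_eq_zero.1 ((mul_eq_zero.1 (?_ : n * _ = 0)).resolve_left hn0)
      linear_combination X 0 * hw1 + X 1 * hw2 - hd' + γ * hX
    · intro hX
      refine sub_eq_zero.1 ((mul_eq_zero.1 (?_ : γ * _ = 0)).resolve_left hγ0)
      linear_combination -X 0 * hw1 - X 1 * hw2 + hd' + n * hX
  refine ⟨?_, ?_⟩
  · rw [← hx, h0]
    exact K.sub_mem (K.add_mem hP.1 (K.mul_mem hkK ha₁)) (K.mul_mem htK ha₂)
  · rw [← hy, h1]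
    exact K.add_mem (K.add_mem hP.2 (K.mul_mem hkK ha₂)) (K.mul_mem htK ha₁)

theorem CubicClosed.over_of_foldable (hK : CubicClosed K) {o : FoldObject}
    (h : Foldable o) : o.Over K := by
  induction h with
  | base P h => exact h.pointOver
  | join P Q l _ _ hPQ hPl hQl hP hQ => exact PointOver.lineOver_of_mem hP hQ hPQ hPl hQl
  | meet l m P _ _ hlm hPl hPm hl hm => exact LineOver.pointOver_of_mem hl hm hlm hPl hPm
  | perpBisector P Q b _ _ hPQ hb hP hQ =>
    exact PointOver.lineOver_perpBisector hP hQ (hasEquation_perpBisector hPQ hb)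
  | bisector l m P b _ _ hlm hPl hPm hPb hb hl hm =>
    have hP := LineOver.pointOver_of_mem hl hm hlm hPl hPm
    -- A bisector is a crease through `P` folding a second point `A` of `l` onto `m`.
    obtain ⟨A, hA, hAl, hAP⟩ := LineOver.exists_ne hl hP hPl
    refine hK.sqrtClosed.lineOver_of_fold hm hA hP (fun hAb => hlm ?_) hPb (hb A hAl)
    have hAm := hb A hAl
    rw [Line.fold_eq_self_iff.2 hAb] at hAm
    exact Line.eq_of_mem hAP hAl hPl hAm hPm
  | fold l P Q b _ _ _ hPl hQb hfold hl hP hQ =>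
    exact hK.sqrtClosed.lineOver_of_fold hl hP hQ
      (fun h => hPl (by rwa [Line.fold_eq_self_iff.2 h] at hfold)) hQb hfold
  | doubleFold l m P Q b _ _ _ _ hPl hQm hne h1 h2 hl hm hP hQ =>
    exact hK.lineOver_of_doubleFold hl hm hP hQ hPl hQm hne h1 h2

end

/-! ### Explicit ruler and compass constructions. -/

theorem HasEquation.ne_of_det_ne_zero {l m : Line} {a b c a' b' c' : ℝ} (hl : HasEquation l a b c)
    (hm : HasEquation m a' b' c') {x y : ℝ} (h1 : a * x + b * y = c) (h2 : a' * x + b' * y = c')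
    (hd : a * b' - a' * b ≠ 0) : l ≠ m := by
  rintro rfl
  refine hd ?_
  have := (hm.2 (pt (x - b) (y + a))).1 ((hl.2 _).2 (by simp only [pt_zero, pt_one]; linarith))
  simp only [pt_zero, pt_one] at this
  linarith

theorem sq_add_sq_pos {a b : ℝ} (h : a ≠ 0 ∨ b ≠ 0) : 0 < a ^ 2 + b ^ 2 := by
  rcases h with h | h
  · have := pow_pos (abs_pos.2 h) 2; rw [sq_abs] at this; positivity
  · have := pow_pos (abs_pos.2 h) 2; rw [sq_abs] at this; positivity

/-- The point `(x, y)` can be drawn with ruler and compass. -/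
def DrawPt (x y : ℝ) : Prop := Drawable (.point (pt x y))

/-- The line `a x + b y = c` can be drawn with ruler and compass. -/
def DrawLine (a b c : ℝ) : Prop := ∃ l, HasEquation l a b c ∧ Drawable (.line l)

theorem DrawPt.join {x y x' y' a b c : ℝ} (hP : DrawPt x y) (hQ : DrawPt x' y')
    (hne : x ≠ x' ∨ y ≠ y') (hab : a ≠ 0 ∨ b ≠ 0) (h1 : a * x + b * y = c)
    (h2 : a * x' + b * y' = c) : DrawLine a b c := by
  have hl := hasEquation_lineOf (c := c) (sq_add_sq_pos hab)
  refine ⟨_, hl, Drawable.join _ _ _ hP hQ (fun h => ?_) ((hl.2 _).2 h1) ((hl.2 _).2 h2)⟩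
  rw [pt_inj] at h
  tauto

theorem DrawLine.meet {a b c a' b' c' x y : ℝ} (hl : DrawLine a b c) (hm : DrawLine a' b' c')
    (hd : a * b' - a' * b ≠ 0) (h1 : a * x + b * y = c) (h2 : a' * x + b' * y = c') :
    DrawPt x y := by
  obtain ⟨l, hl, hl'⟩ := hl
  obtain ⟨m, hm, hm'⟩ := hm
  exact Drawable.meetLineLine l m _ hl' hm' (hl.ne_of_det_ne_zero hm h1 h2 hd) ((hl.2 _).2 h1)
    ((hm.2 _).2 h2)

theorem DrawPt.circle {x y p q p' q' r : ℝ} (hP : DrawPt x y) (hQ : DrawPt p q)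
    (hR : DrawPt p' q') (hr : 0 < r) (h : (p - p') ^ 2 + (q - q') ^ 2 = r ^ 2) :
    Drawable (.circle ⟨pt x y, r⟩) := by
  have hd : dist (pt p q) (pt p' q') = r := (dist_eq_iff hr.le).2 h
  rw [← hd]
  exact Drawable.compass _ _ _ hP hQ hR (dist_pos.1 (hd ▸ hr))

theorem DrawLine.meet_circle {a b c x y p q r : ℝ} (hl : DrawLine a b c)
    (hs : Drawable (.circle ⟨pt p q, r⟩)) (hr : 0 ≤ r) (h1 : a * x + b * y = c)
    (h2 : (x - p) ^ 2 + (y - q) ^ 2 = r ^ 2) : DrawPt x y := by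
  obtain ⟨l, hl, hl'⟩ := hl
  exact Drawable.meetLineCircle l _ _ hl' hs ((hl.2 _).2 h1) ((dist_eq_iff hr).2 h2)

theorem drawPt_zero_zero : DrawPt 0 0 := Drawable.base _ (Or.inl rfl)

theorem drawPt_one_zero : DrawPt 1 0 := Drawable.base _ (Or.inr rfl)

theorem drawLine_xAxis : DrawLine 0 1 0 :=
  drawPt_zero_zero.join drawPt_one_zero (by simp) (by simp) (by simp) (by simp)

theorem DrawPt.unitCircle {x y : ℝ} (h : DrawPt x y) : Drawable (.circle ⟨pt x y, 1⟩) :=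
  h.circle drawPt_zero_zero drawPt_one_zero one_pos (by norm_num)

theorem drawPt_int_zero (n : ℤ) : DrawPt n 0 := by
  induction n with
  | zero => simpa using drawPt_zero_zero
  | succ n ih => exact drawLine_xAxis.meet_circle ih.unitCircle one_pos.le (by simp) (by simp)
  | pred n ih =>
    exact drawLine_xAxis.meet_circle ih.unitCircle one_pos.le (by simp) (by push_cast; ring)

/-- Two circles of radius `2` meet above the midpoint of their centres. -/
theorem drawLine_vertical_int (n : ℤ) : DrawLine 1 0 n := by
  have hr : ∀ m : ℤ, Drawable (.circle ⟨pt m 0, 2⟩) := fun m =>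
    (drawPt_int_zero m).circle drawPt_zero_zero (drawPt_int_zero 2) two_pos (by norm_num)
  have h3 : √3 ^ 2 = (3 : ℝ) := Real.sq_sqrt (by norm_num)
  have hP : DrawPt n (√3) := by
    refine Drawable.meetCircleCircle _ _ _ (hr (n - 1)) (hr (n + 1)) (fun h => ?_)
      ((dist_eq_iff two_pos.le).2 ?_) ((dist_eq_iff two_pos.le).2 ?_)
    · have := (pt_inj.1 (congrArg EuclideanGeometry.Sphere.center h)).1
      push_cast at this
      linarith
    · simp only [pt_zero, pt_one]; push_cast; linear_combination h3
    · simp only [pt_zero, pt_one]; push_cast; linear_combination h3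
  exact (drawPt_int_zero n).join hP (Or.inr (by positivity)) (by simp) (by simp) (by simp)

theorem drawPt_int_int (m n : ℤ) : DrawPt m n := by
  induction n with
  | zero => simpa using drawPt_int_zero m
  | succ n ih =>
    exact (drawLine_vertical_int m).meet_circle ih.unitCircle one_pos.le (by simp) (by simp)
  | pred n ih =>
    exact (drawLine_vertical_int m).meet_circle ih.unitCircle one_pos.le (by simp)
      (by push_cast; ring)

/-- A line of slope `q.den` through two integral points crosses the horizontal axis at `q`. -/
theorem drawPt_rat (q : ℚ) : DrawPt q 0 := by
  have hq : (q.den : ℝ) ≠ 0 := by exact_mod_cast q.den_nz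
  have hl : DrawLine (q.den : ℝ) (-1) q.num :=
    (drawPt_int_int 0 (-q.num)).join (drawPt_int_int 1 (q.den - q.num)) (by simp) (by simp)
      (by push_cast; ring) (by push_cast; ring)
  refine hl.meet drawLine_xAxis (by simp [q.den_nz]) ?_ (by simp)
  rw [Rat.cast_def]
  field_simp
  ring

theorem range_ratCast_subset_rulerCompassNumbers :
    Set.range (fun q : ℚ => (q : ℝ)) ⊆ rulerCompassNumbers := by
  rintro _ ⟨q, rfl⟩
  exact ⟨_, _, drawPt_rat q, drawPt_zero_zero, (dist_eq_iff (abs_nonneg _)).2 (by simp)⟩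

theorem sqrt_two_mem_rulerCompassNumbers : √2 ∈ rulerCompassNumbers := by
  refine ⟨_, _, drawPt_int_int 1 0, drawPt_int_int 0 1, (dist_eq_iff (abs_nonneg _)).2 ?_⟩
  simp only [pt_zero, pt_one, sq_abs]
  rw [Real.sq_sqrt zero_le_two]
  norm_num

/-! ### Explicit paper folding: field operations, square roots, the cube root of 2. -/

/-- The point `(x, y)` can be folded. -/
def FoldPt (x y : ℝ) : Prop := Foldable (.point (pt x y))

/-- The line `a x + b y = c` can be folded. -/
def FoldLine (a b c : ℝ) : Prop := ∃ l, HasEquation l a b c ∧ Foldable (.line l)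

/-- Supplying the quotient `k` explicitly removes the division from `fold_apply`, so that concrete
creases are checked by simple identities. -/
theorem HasEquation.fold_eq {l : Line} {a b c k x y : ℝ} (h : HasEquation l a b c)
    (hk : a * x + b * y - c = k * (a ^ 2 + b ^ 2)) :
    l.fold (pt x y) = pt (x - 2 * k * a) (y - 2 * k * b) := by
  rw [h.fold_apply, pt_zero, pt_one, hk, mul_div_assoc, mul_div_cancel_right₀ _ h.1.ne']

theorem FoldPt.join {x y x' y' a b c : ℝ} (hP : FoldPt x y) (hQ : FoldPt x' y')
    (hne : x ≠ x' ∨ y ≠ y') (hab : a ≠ 0 ∨ b ≠ 0) (h1 : a * x + b * y = c)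
    (h2 : a * x' + b * y' = c) : FoldLine a b c := by
  have hl := hasEquation_lineOf (c := c) (sq_add_sq_pos hab)
  refine ⟨_, hl, Foldable.join _ _ _ hP hQ (fun h => ?_) ((hl.2 _).2 h1) ((hl.2 _).2 h2)⟩
  rw [pt_inj] at h
  tauto

theorem FoldLine.meet {a b c a' b' c' x y : ℝ} (hl : FoldLine a b c) (hm : FoldLine a' b' c')
    (hd : a * b' - a' * b ≠ 0) (h1 : a * x + b * y = c) (h2 : a' * x + b' * y = c') :
    FoldPt x y := by
  obtain ⟨l, hl, hl'⟩ := hl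
  obtain ⟨m, hm, hm'⟩ := hm
  exact Foldable.meet l m _ hl' hm' (hl.ne_of_det_ne_zero hm h1 h2 hd) ((hl.2 _).2 h1)
    ((hm.2 _).2 h2)

/-- The lines `l` and `m` meet at `(x, y)`, and the normal vector of `m` is a multiple of the
reflection of that of `l`. -/
theorem FoldLine.bisector {a b c a' b' c' α β γ x y s k : ℝ} (hl : FoldLine a b c)
    (hm : FoldLine a' b' c') (hd : a * b' - a' * b ≠ 0) (hab : α ≠ 0 ∨ β ≠ 0)
    (h1 : a * x + b * y = c) (h2 : a' * x + b' * y = c') (h3 : α * x + β * y = γ)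
    (hs : a * α + b * β = s * (α ^ 2 + β ^ 2)) (ha : a' = k * (a - 2 * s * α))
    (hb : b' = k * (b - 2 * s * β)) : FoldLine α β γ := by
  obtain ⟨l, hl, hl'⟩ := hl
  obtain ⟨m, hm, hm'⟩ := hm
  have hpos := sq_add_sq_pos hab
  have hr := hasEquation_lineOf (c := γ) hpos
  refine ⟨_, hr, Foldable.bisector l m (pt x y) _ hl' hm' (hl.ne_of_det_ne_zero hm h1 h2 hd)
    ((hl.2 _).2 h1) ((hm.2 _).2 h2) ((hr.2 _).2 h3) fun X hX => (hm.2 _).2 ?_⟩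
  have hX' := (hl.2 X).1 hX
  obtain ⟨r, hr'⟩ : ∃ r, α * X 0 + β * X 1 - γ = r * (α ^ 2 + β ^ 2) :=
    ⟨_, (div_mul_cancel₀ _ hpos.ne').symm⟩
  rw [← pt_eta X, hr.fold_eq hr', pt_zero, pt_one]
  rw [ha, hb] at h2 ⊢
  linear_combination k * (hX' - h1) + h2 - 2 * k * r * hs - 2 * k * s * hr' +
    2 * k * s * h3

theorem FoldPt.perpBisector {x y x' y' a b c k : ℝ} (hP : FoldPt x y) (hQ : FoldPt x' y')
    (hab : a ≠ 0 ∨ b ≠ 0) (hk : a * x + b * y - c = k * (a ^ 2 + b ^ 2))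
    (hx : x' = x - 2 * k * a) (hy : y' = y - 2 * k * b) (hk0 : k ≠ 0) : FoldLine a b c := by
  have hl := hasEquation_lineOf (c := c) (sq_add_sq_pos hab)
  refine ⟨_, hl, Foldable.perpBisector _ _ _ hP hQ (fun h => ?_)
    (Line.toAffine_eq_perpBisector_iff.2 fun X => ?_)⟩
  · obtain ⟨h1, h2⟩ := pt_inj.1 h
    rcases hab with h | h
    · exact mul_ne_zero (mul_ne_zero two_ne_zero hk0) h (by linarith)
    · exact mul_ne_zero (mul_ne_zero two_ne_zero hk0) h (by linarith)
  · rw [hl.2, dist_eq_dist_iff, hx, hy]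
    simp only [pt_zero, pt_one]
    constructor
    · intro h
      linear_combination (-4 * k) * h + 4 * k * hk
    · intro h
      refine sub_eq_zero.1 ((mul_eq_zero.1 (?_ : k * _ = 0)).resolve_left hk0)
      linear_combination (-1 / 4) * h + k * hk

theorem FoldLine.fold {a b c a' b' c' p q u v k : ℝ} (hl : FoldLine a b c) (hP : FoldPt p q)
    (hQ : FoldPt u v) (hab : a' ≠ 0 ∨ b' ≠ 0) (hPl : a * p + b * q ≠ c) (h1 : a' * u + b' * v = c')
    (hk : a' * p + b' * q - c' = k * (a' ^ 2 + b' ^ 2))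
    (h2 : a * (p - 2 * k * a') + b * (q - 2 * k * b') = c) : FoldLine a' b' c' := by
  obtain ⟨l, hl, hl'⟩ := hl
  have hr := hasEquation_lineOf (c := c') (sq_add_sq_pos hab)
  exact ⟨_, hr, Foldable.fold l _ _ _ hl' hP hQ (fun h => hPl ((hl.2 _).1 h)) ((hr.2 _).2 h1)
    ((hl.2 _).2 (by rw [hr.fold_eq hk]; exact h2))⟩

theorem foldPt_zero_zero : FoldPt 0 0 := Foldable.base _ (Or.inl rfl)

theorem foldPt_one_zero : FoldPt 1 0 := Foldable.base _ (Or.inr rfl)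

theorem foldLine_xAxis : FoldLine 0 1 0 :=
  foldPt_zero_zero.join foldPt_one_zero (by simp) (by simp) (by simp) (by simp)

theorem FoldPt.foldLine_half {a : ℝ} (h : FoldPt a 0) (ha : a ≠ 0) : FoldLine 1 0 (a / 2) :=
  foldPt_zero_zero.perpBisector (k := -a / 2) h (by simp) (by ring) (by ring) (by ring)
    (by simpa using ha)

/-- The lines through the origin that form an angle of `30°` with the horizontal axis. -/
theorem foldLine_sqrt_three {s : ℝ} (hs : s ^ 2 = 3) : FoldLine 1 s 0 := by
  -- The crease through the origin carries `(1, 0)` to `(1/2, -s/2)`, on the perpendicular bisector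
  -- of the unit segment.
  refine (foldPt_one_zero.foldLine_half one_ne_zero).fold (k := 1 / 4) foldPt_one_zero
    foldPt_zero_zero ?_ ?_ ?_ ?_ ?_
  · simp
  · norm_num
  · simp
  · rw [hs]; norm_num
  · norm_num

/-- The two lines at 30° to the horizontal are mirror images in the vertical axis. -/
theorem foldLine_yAxis : FoldLine 1 0 0 := by
  have h3 : √3 ^ 2 = (3 : ℝ) := Real.sq_sqrt (by norm_num)
  have hpos : (0 : ℝ) < √3 := by positivity
  refine (foldLine_sqrt_three h3).bisector (x := 0) (y := 0) (s := 1) (k := -1)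
    (foldLine_sqrt_three (s := -√3) (by rw [neg_sq, h3])) ?_ ?_ ?_ ?_ ?_ ?_ ?_ ?_
  · linarith
  all_goals norm_num

theorem foldLine_diagonal : FoldLine 1 (-1) 0 :=
  foldLine_xAxis.bisector (x := 0) (y := 0) (s := -1 / 2) (k := 1) foldLine_yAxis
    (by norm_num) (by norm_num) (by norm_num) (by norm_num) (by norm_num) (by norm_num)
    (by norm_num) (by norm_num)

theorem foldLine_antidiagonal : FoldLine 1 1 0 :=
  foldLine_xAxis.bisector (x := 0) (y := 0) (s := 1 / 2) (k := -1) foldLine_yAxis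
    (by norm_num) (by norm_num) (by norm_num) (by norm_num) (by norm_num) (by norm_num)
    (by norm_num) (by norm_num)

section

variable {a b : ℝ}

theorem FoldPt.foldLine_one_one (h : FoldPt a 0) : FoldLine 1 1 a := by
  rcases eq_or_ne a 0 with rfl | ha
  · exact foldLine_antidiagonal
  · exact h.join ((h.foldLine_half ha).meet (x := a / 2) (y := a / 2) foldLine_diagonal
      (by norm_num) (by ring) (by ring)) (Or.inr (div_ne_zero ha two_ne_zero).symm) (by simp) (by ring)
      (by ring)

theorem FoldPt.foldLine_one_neg_one (h : FoldPt a 0) : FoldLine 1 (-1) a := by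
  rcases eq_or_ne a 0 with rfl | ha
  · exact foldLine_diagonal
  · exact h.join ((h.foldLine_half ha).meet (x := a / 2) (y := -(a / 2)) foldLine_antidiagonal
      (by norm_num) (by ring) (by ring)) (Or.inr (by simpa using ha)) (by simp) (by ring)
      (by ring)

/-- The perpendicular at `(a, 0)` bisects the two lines of slope ±1 through that point. -/
theorem FoldPt.vertical (h : FoldPt a 0) : FoldLine 1 0 a :=
  h.foldLine_one_one.bisector (x := a) (y := 0) (s := 1) (k := -1) h.foldLine_one_neg_one
    (by norm_num) (by norm_num) (by norm_num) (by norm_num) (by norm_num) (by norm_num)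
    (by norm_num) (by norm_num)

theorem FoldPt.horizontal (h : FoldPt a 0) : FoldLine 0 1 a := by
  rcases eq_or_ne a 0 with rfl | ha
  · exact foldLine_xAxis
  · exact (h.foldLine_one_one.meet (x := 0) (y := a) foldLine_yAxis (by norm_num) (by ring)
      (by ring)).join (h.vertical.meet (x := a) (y := a) foldLine_diagonal (by norm_num) (by ring)
      (by ring)) (Or.inl ha.symm) (by simp) (by ring) (by ring)

theorem FoldPt.prod (ha : FoldPt a 0) (hb : FoldPt b 0) : FoldPt a b :=
  ha.vertical.meet hb.horizontal (by norm_num) (by ring) (by ring)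

/-- The bisector of slope `-1` at `(a, b)` meets the axis at `a + b`; the one of slope `1` yields `a
- b` in `FoldPt.sub`. -/
theorem FoldPt.add (ha : FoldPt a 0) (hb : FoldPt b 0) : FoldPt (a + b) 0 := by
  have h : FoldLine 1 1 (a + b) :=
    ha.vertical.bisector (x := a) (y := b) (s := 1 / 2) (k := -1) hb.horizontal (by norm_num)
      (by norm_num) (by ring) (by ring) (by ring) (by norm_num) (by norm_num) (by norm_num)
  exact h.meet foldLine_xAxis (by norm_num) (by ring) (by ring)

theorem FoldPt.sub (ha : FoldPt a 0) (hb : FoldPt b 0) : FoldPt (a - b) 0 := by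
  have h : FoldLine 1 (-1) (a - b) :=
    ha.vertical.bisector (x := a) (y := b) (s := 1 / 2) (k := 1) hb.horizontal (by norm_num)
      (by norm_num) (by ring) (by ring) (by ring) (by norm_num) (by norm_num) (by norm_num)
  exact h.meet foldLine_xAxis (by norm_num) (by ring) (by ring)

theorem FoldPt.neg (ha : FoldPt a 0) : FoldPt (-a) 0 := by
  simpa using foldPt_zero_zero.sub ha

theorem FoldPt.div (ha : FoldPt a 0) (hb : FoldPt b 0) : FoldPt (a / b) 0 := by
  -- The convention `a / 0 = 0` lets `inv` and `mul` follow without case distinctions. Otherwise the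
  -- line `y = b x - a` meets the axis at `a / b`.
  rcases eq_or_ne b 0 with rfl | hb0
  · simpa using foldPt_zero_zero
  · have h : FoldLine b (-1) a :=
      (foldPt_zero_zero.prod ha.neg).join (foldPt_one_zero.prod (hb.sub ha)) (by simp)
        (by simp) (by ring) (by ring)
    exact h.meet foldLine_xAxis (by simpa using hb0) (by field_simp; ring) (by ring)

theorem FoldPt.inv (ha : FoldPt a 0) : FoldPt a⁻¹ 0 := by
  simpa using foldPt_one_zero.div ha

theorem FoldPt.mul (ha : FoldPt a 0) (hb : FoldPt b 0) : FoldPt (a * b) 0 := by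
  simpa using ha.div hb.inv

/-- The field of abscissae of points that can be folded. -/
def foldField : Subfield ℝ where
  carrier := {x | FoldPt x 0}
  zero_mem' := foldPt_zero_zero
  one_mem' := foldPt_one_zero
  add_mem' := FoldPt.add
  mul_mem' := FoldPt.mul
  neg_mem' := FoldPt.neg
  inv_mem' _ := FoldPt.inv

theorem PointOver.foldable {P : Plane} (h : PointOver foldField P) : Foldable (.point P) := by
  rw [← pt_eta P]
  exact FoldPt.prod h.1 h.2

/-- A crease through `(0, -s²)` that folds `(0, 1)` onto the line `y = -1` meets the horizontal
axis at `(s, 0)`. -/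
theorem sqrtClosed_foldField : SqrtClosed foldField := by
  intro s hs
  change FoldPt s 0
  replace hs : FoldPt (s ^ 2) 0 := hs
  rcases eq_or_ne s 0 with rfl | hs0
  · exact foldPt_zero_zero
  -- The image of `(0, 1)` is `(2s, -1)`; the crease is the tangent of `x² = 4y` at `(2s, s²)`.
  have h : FoldLine s (-1) (s ^ 2) :=
    foldPt_one_zero.neg.horizontal.fold (k := -1) (foldPt_zero_zero.prod foldPt_one_zero)
      (foldPt_zero_zero.prod hs.neg) (by simp) (by norm_num) (by ring) (by ring) (by ring)
  exact h.meet foldLine_xAxis (by simpa using hs0) (by ring) (by ring)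

/-- The common tangent `y = s x - s²` of the parabolas with focus `(0, 1)`, directrix `y = -1` and
with focus `(-2, 0)`, directrix `x = 2` has slope `s` with `s³ = 2`. -/
theorem foldPt_of_cube_eq_two {s : ℝ} (hs : s ^ 3 = 2) : FoldPt s 0 := by
  have hs0 : s ≠ 0 := by rintro rfl; norm_num at hs
  have h2 : FoldPt 2 0 := by simpa [one_add_one_eq_two] using foldPt_one_zero.add foldPt_one_zero
  obtain ⟨l, hl, hl'⟩ := foldPt_one_zero.neg.horizontal
  obtain ⟨m, hm, hm'⟩ := h2.vertical
  have hb := hasEquation_lineOf (a := s) (b := -1) (c := s ^ 2) (sq_add_sq_pos (by simp))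
  have h : FoldLine s (-1) (s ^ 2) := by
    refine ⟨_, hb, Foldable.doubleFold l m (pt 0 1) (pt (-2) 0) _ hl' hm'
      (foldPt_zero_zero.prod foldPt_one_zero) h2.neg (fun h => ?_) (fun h => ?_) (fun h => ?_)
      ((hl.2 _).2 ?_) ((hm.2 _).2 ?_)⟩
    · have := (hl.2 _).1 h
      norm_num at this
    · have := (hm.2 _).1 h
      norm_num at this
    · have := (pt_inj.1 (Prod.ext_iff.1 h).1).1
      norm_num at this
    · rw [hb.fold_eq (k := -1) (by ring)]
      simp only [pt_zero, pt_one]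
      ring
    -- The image of `(-2, 0)` is `(2, -4/s)`; this is where `s ^ 3 = 2` enters.
    · rw [hb.fold_eq (k := -2 / s) (by field_simp; linear_combination -hs)]
      simp only [pt_zero, pt_one]
      field_simp
      ring
  exact h.meet foldLine_xAxis (by simpa using hs0) (by ring) (by ring)

end

/-! ### Towers of real quadratic extensions and the cube root of 2. -/

/-- The field `F(s)` for a square root `s` of an element of `F`. -/
def quadExt (F : Subfield ℝ) (s : ℝ) (hs : s ^ 2 ∈ F) : Subfield ℝ where
  carrier := {x | ∃ a ∈ F, ∃ b ∈ F, x = a + b * s}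
  zero_mem' := ⟨0, F.zero_mem, 0, F.zero_mem, by ring⟩
  one_mem' := ⟨1, F.one_mem, 0, F.zero_mem, by ring⟩
  add_mem' := by
    rintro _ _ ⟨a, ha, b, hb, rfl⟩ ⟨a', ha', b', hb', rfl⟩
    exact ⟨_, F.add_mem ha ha', _, F.add_mem hb hb', by ring⟩
  mul_mem' := by
    rintro _ _ ⟨a, ha, b, hb, rfl⟩ ⟨a', ha', b', hb', rfl⟩
    exact ⟨_, F.add_mem (F.mul_mem ha ha') (F.mul_mem (F.mul_mem hb hb') hs), _,
      F.add_mem (F.mul_mem ha hb') (F.mul_mem ha' hb), by ring⟩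
  neg_mem' := by
    rintro _ ⟨a, ha, b, hb, rfl⟩
    exact ⟨_, F.neg_mem ha, _, F.neg_mem hb, by ring⟩
  inv_mem' := by
    rintro _ ⟨a, ha, b, hb, rfl⟩
    by_cases h1 : a + b * s = 0
    · exact ⟨0, F.zero_mem, 0, F.zero_mem, by rw [h1]; simp⟩
    -- Since `s` may already lie in `F`, the conjugate can vanish; then `a + b s = 2a`.
    by_cases h2 : a - b * s = 0
    · refine ⟨_, F.inv_mem (F.add_mem ha ha), 0, F.zero_mem, ?_⟩
      rw [← sub_eq_zero.1 h2]
      ring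
    · have hd : a ^ 2 - b ^ 2 * s ^ 2 ∈ F :=
        F.sub_mem (pow_mem ha 2) (F.mul_mem (pow_mem hb 2) hs)
      have hd0 : a ^ 2 - b ^ 2 * s ^ 2 ≠ 0 := by
        rw [show a ^ 2 - b ^ 2 * s ^ 2 = (a + b * s) * (a - b * s) by ring]
        exact mul_ne_zero h1 h2
      refine ⟨_, F.div_mem ha hd, _, F.div_mem (F.neg_mem hb) hd, ?_⟩
      field_simp
      ring

theorem le_quadExt (F : Subfield ℝ) (s : ℝ) (hs : s ^ 2 ∈ F) : F ≤ quadExt F s hs :=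
  fun x hx => ⟨x, hx, 0, F.zero_mem, by ring⟩

theorem mem_quadExt_self (F : Subfield ℝ) (s : ℝ) (hs : s ^ 2 ∈ F) : s ∈ quadExt F s hs :=
  ⟨0, F.zero_mem, 1, F.one_mem, by ring⟩

theorem quadExt_mono {F G : Subfield ℝ} (h : F ≤ G) (s : ℝ) (hs : s ^ 2 ∈ F) :
    quadExt F s hs ≤ quadExt G s (h hs) := by
  rintro _ ⟨a, ha, b, hb, rfl⟩
  exact ⟨a, h ha, b, h hb, rfl⟩

/-- The fields reached from the field of rational numbers by finitely many adjunctions of square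
roots. -/
inductive QuadTower : Subfield ℝ → Prop
  | base : QuadTower (algebraMap ℚ ℝ).fieldRange
  | step (F : Subfield ℝ) (s : ℝ) (hs : s ^ 2 ∈ F) : QuadTower F → QuadTower (quadExt F s hs)

/-- The square roots of the second tower are adjoined one by one on top of `F`. This directedness
makes the union of all towers a field. -/
theorem QuadTower.exists_le {F G : Subfield ℝ} (hF : QuadTower F) (hG : QuadTower G) :
    ∃ H, QuadTower H ∧ F ≤ H ∧ G ≤ H := by
  induction hG with
  | base =>
    refine ⟨F, hF, le_rfl, ?_⟩
    rintro _ ⟨q, rfl⟩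
    simp
  | step G s hs _ ih =>
    obtain ⟨H, hH, hFH, hGH⟩ := ih
    exact ⟨_, hH.step H s (hGH hs), hFH.trans (le_quadExt _ _ _), quadExt_mono hGH s hs⟩

/-- The union of all towers of real quadratic extensions of the rational numbers. -/
def quadClosure : Subfield ℝ where
  carrier := {x | ∃ F, QuadTower F ∧ x ∈ F}
  zero_mem' := ⟨_, .base, Subfield.zero_mem _⟩
  one_mem' := ⟨_, .base, Subfield.one_mem _⟩
  add_mem' := by
    rintro x y ⟨F, hF, hx⟩ ⟨G, hG, hy⟩
    obtain ⟨H, hH, hFH, hGH⟩ := hF.exists_le hG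
    exact ⟨H, hH, H.add_mem (hFH hx) (hGH hy)⟩
  mul_mem' := by
    rintro x y ⟨F, hF, hx⟩ ⟨G, hG, hy⟩
    obtain ⟨H, hH, hFH, hGH⟩ := hF.exists_le hG
    exact ⟨H, hH, H.mul_mem (hFH hx) (hGH hy)⟩
  neg_mem' := by
    rintro x ⟨F, hF, hx⟩
    exact ⟨F, hF, F.neg_mem hx⟩
  inv_mem' := by
    rintro x ⟨F, hF, hx⟩
    exact ⟨F, hF, F.inv_mem hx⟩

theorem sqrtClosed_quadClosure : SqrtClosed quadClosure := by
  rintro s ⟨F, hF, hs⟩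
  exact ⟨_, hF.step F s hs, mem_quadExt_self F s hs⟩

theorem rat_cube_ne_two (q : ℚ) : q ^ 3 ≠ 2 := by
  intro h
  have hq : Irrational (q : ℝ) := by
    refine irrational_nrt_of_notint_nrt 3 2 (by exact_mod_cast h) ?_ (by norm_num)
    rintro ⟨n, hn⟩
    have h3 : n ^ 3 = 2 := by
      have : ((n : ℝ)) ^ 3 = 2 := by rw [← hn]; exact_mod_cast h
      exact_mod_cast this
    have h1 : n < 2 := by
      by_contra! h2
      have := pow_le_pow_left₀ (by norm_num) h2 3
      omega
    have h2 : 0 < n := by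
      by_contra! h0
      have := Odd.pow_nonpos (n := 3) (by decide) h0
      omega
    obtain rfl : n = 1 := by omega
    norm_num at h3
  exact hq ⟨q, rfl⟩

/-- Descent along the tower: in `(a + b s)³ = 2` the coefficient of `s` either is nonzero, so that
`s ∈ F`, or vanishes, and uniqueness of real cube roots gives `b s = 0`. Either way the cube root
lies one level lower, and finally in ℚ. -/
theorem QuadTower.cube_ne_two {F : Subfield ℝ} (hF : QuadTower F) {x : ℝ} (hx : x ∈ F) :
    x ^ 3 ≠ 2 := by
  induction hF generalizing x with
  | base =>
    obtain ⟨q, rfl⟩ := hx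
    intro h
    rw [eq_ratCast] at h
    exact rat_cube_ne_two q (by exact_mod_cast h)
  | step F s hs _ ih =>
    obtain ⟨a, ha, b, hb, rfl⟩ := hx
    intro h
    have hd : 3 * a ^ 2 * b + b ^ 3 * s ^ 2 ∈ F := F.add_mem
      (F.mul_mem (F.mul_mem (ofNat_mem F 3) (pow_mem ha 2)) hb) (F.mul_mem (pow_mem hb 3) hs)
    by_cases hd0 : 3 * a ^ 2 * b + b ^ 3 * s ^ 2 = 0
    · -- the conjugate `a - b s` is another cube root of `2`
      have hc : (a - b * s) ^ 3 = (a + b * s) ^ 3 := by linear_combination (-2 * s) * hd0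
      have hbs : a - b * s = a + b * s := (Odd.strictMono_pow (by decide)).injective hc
      refine ih ha ?_
      rwa [show b * s = 0 by linarith, add_zero] at h
    · have hs' : s = (2 - a ^ 3 - 3 * a * b ^ 2 * s ^ 2) / (3 * a ^ 2 * b + b ^ 3 * s ^ 2) := by
        rw [eq_div_iff hd0]
        linear_combination h
      have hsF : s ∈ F := by
        rw [hs']
        exact F.div_mem (F.sub_mem (F.sub_mem (ofNat_mem F 2) (pow_mem ha 3)) (F.mul_mem
          (F.mul_mem (F.mul_mem (ofNat_mem F 3) ha) (pow_mem hb 2)) hs)) hd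
      exact ih (F.add_mem ha (F.mul_mem hb hsF)) h

/-! ### From points to lengths; algebraic and transcendental numbers. -/

theorem SqrtClosed.rulerCompassNumbers_subset {K : Subfield ℝ} (hK : SqrtClosed K) :
    rulerCompassNumbers ⊆ K := by
  rintro x ⟨P, Q, hP, hQ, h⟩
  refine hK x ?_
  rw [← sq_abs, ← h]
  exact PointOver.dist_sq_mem (hK.over_of_drawable hP) (hK.over_of_drawable hQ)

theorem CubicClosed.origamiNumbers_subset {K : Subfield ℝ} (hK : CubicClosed K) :
    origamiNumbers ⊆ K := by
  rintro x ⟨P, Q, hP, hQ, h⟩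
  refine hK.sqrtClosed x ?_
  rw [← sq_abs, ← h]
  exact PointOver.dist_sq_mem (hK.over_of_foldable hP) (hK.over_of_foldable hQ)

theorem FoldPt.mem_origamiNumbers {x : ℝ} (h : FoldPt x 0) : x ∈ origamiNumbers :=
  ⟨_, _, h, foldPt_zero_zero, (dist_eq_iff (abs_nonneg _)).2 (by simp)⟩

theorem mem_algebraicClosure_of_isAlgebraic {F E : Type*} [Field F] [Field E] [Algebra F E] {t : E}
    (h : IsAlgebraic (algebraicClosure F E) t) : t ∈ algebraicClosure F E :=
  mem_algebraicClosure_iff.2 (h.restrictScalars F)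

theorem cubicClosed_algebraicClosure : CubicClosed (algebraicClosure ℚ ℝ).toSubfield := by
  intro a ha b hb c hc d hd t ht
  by_cases h0 : a = 0 ∧ b = 0 ∧ c = 0 ∧ d = 0
  · exact Or.inr h0
  refine Or.inl ?_
  let p : Cubic (algebraicClosure ℚ ℝ) := ⟨⟨a, ha⟩, ⟨b, hb⟩, ⟨c, hc⟩, ⟨d, hd⟩⟩
  have hp : p.toPoly ≠ 0 := by
    intro h
    have h' := Cubic.toPoly_injective p 0 |>.1 (h.trans Cubic.zero.symm)
    refine h0 ⟨?_, ?_, ?_, ?_⟩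
    · exact congrArg (fun q : Cubic (algebraicClosure ℚ ℝ) => (q.a : ℝ)) h'
    · exact congrArg (fun q : Cubic (algebraicClosure ℚ ℝ) => (q.b : ℝ)) h'
    · exact congrArg (fun q : Cubic (algebraicClosure ℚ ℝ) => (q.c : ℝ)) h'
    · exact congrArg (fun q : Cubic (algebraicClosure ℚ ℝ) => (q.d : ℝ)) h'
  have halg : IsAlgebraic (algebraicClosure ℚ ℝ) t := by
    refine ⟨p.toPoly, hp, ?_⟩
    simp only [Cubic.toPoly, p, map_add, map_mul, map_pow, Polynomial.aeval_C, Polynomial.aeval_X]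
    exact ht
  exact mem_algebraicClosure_of_isAlgebraic halg

/-- Cantor's argument: the algebraic numbers are countable, ℝ is not. -/
theorem exists_transcendental : ∃ x : ℝ, ¬ IsAlgebraic ℚ x := by
  by_contra! h
  have := Algebraic.countable ℚ ℝ
  rw [Set.eq_univ_of_forall (s := {x : ℝ | IsAlgebraic ℚ x}) h] at this
  exact Cardinal.not_countable_real this

end Origami

theorem mainTheorem6 :
    Set.range (fun q : ℚ => (q : ℝ)) ⊂ Origami.rulerCompassNumbers ∧
    Origami.rulerCompassNumbers ⊂ Origami.origamiNumbers ∧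
    Origami.origamiNumbers ⊂ (Set.univ : Set ℝ) := by
  refine ⟨(Set.ssubset_iff_of_subset Origami.range_ratCast_subset_rulerCompassNumbers).2
    ⟨√2, Origami.sqrt_two_mem_rulerCompassNumbers, irrational_sqrt_two⟩,
    (Set.ssubset_iff_of_subset ?_).2 ?_, (Set.ssubset_iff_of_subset (Set.subset_univ _)).2 ?_⟩
  -- The endpoints of a drawn segment have coordinates in `foldField`, so the very same segment can
  -- be folded.
  · rintro x ⟨P, Q, hP, hQ, h⟩
    exact ⟨P, Q, (Origami.sqrtClosed_foldField.over_of_drawable hP).foldable,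
      (Origami.sqrtClosed_foldField.over_of_drawable hQ).foldable, h⟩
  · have h2 : ((2 : ℝ) ^ ((3 : ℕ) : ℝ)⁻¹) ^ 3 = 2 :=
      Real.rpow_inv_natCast_pow zero_le_two three_ne_zero
    refine ⟨_, (Origami.foldPt_of_cube_eq_two h2).mem_origamiNumbers, fun h => ?_⟩
    obtain ⟨F, hF, hx⟩ := Origami.sqrtClosed_quadClosure.rulerCompassNumbers_subset h
    exact hF.cube_ne_two hx h2
  · obtain ⟨x, hx⟩ := Origami.exists_transcendental
    exact ⟨x, Set.mem_univ x, fun h => hx (mem_algebraicClosure_iff.1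
      (Origami.cubicClosed_algebraicClosure.origamiNumbers_subset h))⟩
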